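/- Let $K$ be a field, $G$ a group, $A\subseteq G$ a subset with $1\in A$, and let $H=\mathrm{St}(A)=\{h\in G: hA=A\}$. Suppose that $A$ is a union of finitely many right cosets of $H$, say $A=Hg_1\cup\dots\cup Hg_n$ with $g_1=1$ and $Hg_i\ne Hg_j$ for $i\neq j$. Let $e_{i,j}(h)\in M_n(KH)$ be the matrix whose only non-zero entry is $h\in H$, in row $i$ and column $j$. Let $M_n(KH)_g$ be the $K$-span of all $e_{i,j}(h)$ with $g_i^{-1}hg_j=g$ (the elementary grading determined by $A$ and the $g_i$). Put $A_i=g_i^{-1}A$ and let $\pi:G\to M_n(KH)$ be the elementary partial representation constructed from $A_1,\dots,A_n$, $$\pi(g)=\sum_{i:\ g^{-1}\in A_i} e_{j(i),i}\bigl(g_{j(i)}\,g\,g_i^{-1}\bigr),\qquad\text{where } gA_i=A_{j(i)}.$$ Let $\varepsilon_g=\pi(g)\pi(g^{-1})$, let $\mathcal A$ be the subalgebra of $M_n(KH)$ generated by all $\varepsilon_g$ $(g\in G)$, let $\mathcal D_g=\varepsilon_g\mathcal A$, and let $\alpha^\pi$ be the partial action of $G$ on $\mathcal A$ given by the isomorphisms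 $\alpha^\pi_g:\mathcal D_{g^{-1}}\to\mathcal D_g$, $a\mapsto\pi(g)a\pi(g^{-1})$. Let $\mathcal A\rtimes_{\alpha^\pi}G$ be its skew group ring, i.e. the set of finite formal sums $\sum_g a_g\delta_g$ $(a_g\in\mathcal D_g)$ with the product $(a_g\delta_g)(b_h\delta_h)=\alpha^\pi_g\bigl(\alpha^\pi_{g^{-1}}(a_g)b_h\bigr)\delta_{gh}$, and with homogeneous components $\mathcal D_g\delta_g$. Then the subspaces $M_n(KH)_g$ form a $G$-grading of the algebra $M_n(KH)$ and the subspaces $\mathcal D_g\delta_g$ form a $G$-grading of $\mathcal A\rtimes_{\alpha^\pi}G$; the algebra $\mathcal A$ equals $\mathrm{diag}(K,\dots,K)\cong K^n$; and the map $$\phi_\pi: K^n\rtimes_{\alpha^\pi}G=\mathcal A\rtimes_{\alpha^\pi}G\to M_n(KH),\qquad \sum_{g} a_g\delta_g\mapsto\sum_{g} a_g\pi(g),$$ is an isomorphism of $G$-graded $K$-algebras: it is $K$-linear, bijective and multiplicative, and $\phi_\pi(\mathcal D_g\delta_g)=M_n(KH)_g$ for every $g\in G$. -/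

import Mathlib

open scoped Pointwise DirectSum

noncomputable section

/-! # Partial actions and skew group rings -/

/-- A partial action of a group `G` on a (not necessarily unital) associative `K`-algebra `A`:
two-sided ideals `D g` and algebra isomorphisms `act g : D g⁻¹ → D g` such that `D 1 = A`,
`act 1` is the identity, and `act (g * h)` extends the composite `act g ∘ act h`. -/
structure PartialAction (K G A : Type*) [Field K] [Group G] [NonUnitalRing A] [Module K A] where
  /-- the ideals `D g` -/
  D : G → Submodule K A
  mul_mem_left : ∀ (g : G) (a x : A), x ∈ D g → a * x ∈ D g
  mul_mem_right : ∀ (g : G) (a x : A), x ∈ D g → x * a ∈ D g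
  /-- the isomorphisms `D g⁻¹ → D g` -/
  act : ∀ g : G, D g⁻¹ ≃ₗ[K] D g
  act_mul : ∀ (g : G) (x y : D g⁻¹),
    (act g ⟨(x : A) * y, mul_mem_left _ _ _ y.2⟩ : A) = act g x * act g y
  D_one : D 1 = ⊤
  act_one : ∀ x : D (1 : G)⁻¹, (act 1 x : A) = x
  mem_of_act_mem : ∀ (g h : G) (x : D h⁻¹), (act h x : A) ∈ D g⁻¹ → (x : A) ∈ D (g * h)⁻¹
  act_act : ∀ (g h : G) (x : D h⁻¹) (hx : (act h x : A) ∈ D g⁻¹),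
    (act g ⟨act h x, hx⟩ : A) = act (g * h) ⟨x, mem_of_act_mem g h x hx⟩

namespace PartialAction

variable {K G A : Type*} [Field K] [Group G] [NonUnitalRing A] [Module K A]

lemma act_congr (α : PartialAction K G A) {g h : G} (e : g = h) (x : A)
    (hx : x ∈ α.D g⁻¹) (hx' : x ∈ α.D h⁻¹) : (α.act g ⟨x, hx⟩ : A) = α.act h ⟨x, hx'⟩ := by
  subst e; rfl

lemma act_mem_inv_inv (α : PartialAction K G A) (g : G) (x : α.D g⁻¹) :
    (α.act g x : A) ∈ α.D g⁻¹⁻¹ := by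
  rw [inv_inv]; exact (α.act g x).2

/-- The isomorphism `act g⁻¹` is inverse to `act g`. -/
lemma act_inv_act (α : PartialAction K G A) (g : G) (x : α.D g⁻¹) :
    (α.act g⁻¹ ⟨α.act g x, α.act_mem_inv_inv g x⟩ : A) = x := by
  rw [α.act_act g⁻¹ g x]
  have h1 : (x : A) ∈ α.D (1 : G)⁻¹ := by rw [inv_one, α.D_one]; trivial
  rw [α.act_congr (inv_mul_cancel g) x _ h1, α.act_one]

/-- `act g` maps `D g⁻¹ ∩ D h` into `D (g * h)`. -/
lemma act_mem (α : PartialAction K G A) (g h : G) (x : α.D g⁻¹) (hx : (x : A) ∈ α.D h) :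
    (α.act g x : A) ∈ α.D (g * h) := by
  have := α.mem_of_act_mem h⁻¹ g⁻¹ ⟨α.act g x, α.act_mem_inv_inv g x⟩
    (by rw [α.act_inv_act, inv_inv]; exact hx)
  simpa using this

variable [IsScalarTower K A A] [SMulCommClass K A A]

/-- The product `(a δ_g) (b δ_h)` has coefficient `act g ((act g)⁻¹ a * b)` at `g * h`; here
`(act g)⁻¹ = act g⁻¹`. This is the coefficient as a bilinear function of `a` and `b`. -/
def coeffMul (α : PartialAction K G A) (g h : G) :
    α.D g →ₗ[K] α.D h →ₗ[K] α.D (g * h) :=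
  LinearMap.mk₂ K
    (fun a b => ⟨α.act g ⟨((α.act g).symm a : A) * b,
        α.mul_mem_right _ _ _ ((α.act g).symm a).2⟩,
      α.act_mem g h _ (α.mul_mem_left _ _ _ b.2)⟩)
    (by
      intro a a' b
      refine Subtype.ext ?_
      rw [Submodule.coe_add]
      dsimp only
      rw [← Submodule.coe_add, ← map_add]
      exact congrArg (fun z => (α.act g z : A)) (Subtype.ext (by simp [add_mul])))
    (by
      intro c a b
      refine Subtype.ext ?_
      rw [Submodule.coe_smul]
      dsimp only
      rw [← Submodule.coe_smul, ← map_smul]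
      exact congrArg (fun z => (α.act g z : A)) (Subtype.ext (by simp [smul_mul_assoc])))
    (by
      intro a b b'
      refine Subtype.ext ?_
      refine Eq.trans ?_ (Submodule.coe_add ..).symm
      dsimp only
      rw [← Submodule.coe_add, ← map_add]
      exact congrArg (fun z => (α.act g z : A)) (Subtype.ext (by simp [mul_add])))
    (by
      intro c a b
      refine Subtype.ext ?_
      refine Eq.trans ?_ (Submodule.coe_smul ..).symm
      dsimp only
      rw [← Submodule.coe_smul, ← map_smul]
      exact congrArg (fun z => (α.act g z : A)) (Subtype.ext (by simp [mul_smul_comm])))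

lemma coeffMul_apply (α : PartialAction K G A) (g h : G) (a : α.D g) (b : α.D h) :
    (α.coeffMul g h a b : A) = α.act g ⟨((α.act g).symm a : A) * b,
        α.mul_mem_right _ _ _ ((α.act g).symm a).2⟩ := rfl

/-- The underlying space of the skew group ring `A ⋊ G`: finite formal sums `∑ a_g δ_g`
with `a_g ∈ D g`. -/
def SkewGroupRing (α : PartialAction K G A) : Type _ := ⨁ g : G, α.D g

instance (α : PartialAction K G A) : AddCommGroup α.SkewGroupRing :=
  inferInstanceAs (AddCommGroup (⨁ g : G, α.D g))

instance (α : PartialAction K G A) : Module K α.SkewGroupRing :=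
  inferInstanceAs (Module K (⨁ g : G, α.D g))

open scoped Classical in
/-- The element `a δ_g` of the skew group ring, as a linear function of `a ∈ D g`. -/
def delta (α : PartialAction K G A) (g : G) : α.D g →ₗ[K] α.SkewGroupRing :=
  DirectSum.lof K G (fun g => α.D g) g

open scoped Classical in
/-- Multiplication of the skew group ring, the bilinear extension of
`(a δ_g) (b δ_h) = act g ((act g)⁻¹ a * b) δ_{gh}`. -/
def skewMul (α : PartialAction K G A) :
    α.SkewGroupRing →ₗ[K] α.SkewGroupRing →ₗ[K] α.SkewGroupRing :=
  DirectSum.toModule K G _ fun g => LinearMap.flip <|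
    DirectSum.toModule K G _ fun h =>
      LinearMap.flip ((α.coeffMul g h).compr₂ (α.delta (g * h)))

instance (α : PartialAction K G A) : NonUnitalNonAssocRing α.SkewGroupRing where
  mul x y := α.skewMul x y
  left_distrib x y z := map_add (α.skewMul x) y z
  right_distrib x y z := LinearMap.map_add₂ α.skewMul x y z
  zero_mul x := LinearMap.map_zero₂ α.skewMul x
  mul_zero x := map_zero (α.skewMul x)

instance (α : PartialAction K G A) : IsScalarTower K α.SkewGroupRing α.SkewGroupRing where
  smul_assoc c x y := LinearMap.map_smul₂ α.skewMul c x y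

instance (α : PartialAction K G A) : SMulCommClass K α.SkewGroupRing α.SkewGroupRing where
  smul_comm c x y := (map_smul (α.skewMul x) c y).symm

open scoped Classical in
lemma delta_mul_delta (α : PartialAction K G A) (g h : G) (a : α.D g) (b : α.D h) :
    α.delta g a * α.delta h b = α.delta (g * h) (α.coeffMul g h a b) := by
  change α.skewMul _ _ = _
  simp only [skewMul, delta]
  erw [DirectSum.toModule_lof, LinearMap.flip_apply, DirectSum.toModule_lof]
  rfl

/-- The homogeneous component `D g δ_g` of the skew group ring. -/
def homogeneous (α : PartialAction K G A) (g : G) : Submodule K α.SkewGroupRing :=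
  LinearMap.range (α.delta g)

end PartialAction

open scoped Classical in
/-- A family `M g` of subspaces of a `K`-algebra `B` is a `G`-grading of `B`: `B` is the direct sum
of the `M g`, and `M g * M h ⊆ M (g * h)`. -/
structure IsGroupGrading {K G B : Type*} [Field K] [Group G] [NonUnitalNonAssocRing B]
    [Module K B] (M : G → Submodule K B) : Prop where
  isInternal : DirectSum.IsInternal M
  mul_mem : ∀ (g h : G) (x y : B), x ∈ M g → y ∈ M h → x * y ∈ M (g * h)

/-! # Partial representations -/

/-- A partial representation of `G` in a unital `K`-algebra (the scalars play no role). -/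
structure PartialRep (G B : Type*) [Group G] [Ring B] where
  toFun : G → B
  map_one : toFun 1 = 1
  mul_mul_inv : ∀ g h : G, toFun g * toFun h * toFun h⁻¹ = toFun (g * h) * toFun h⁻¹
  inv_mul_mul : ∀ g h : G, toFun g⁻¹ * toFun g * toFun h = toFun g⁻¹ * toFun (g * h)

namespace PartialRep

section Basic

variable {G B : Type*} [Group G] [Ring B]

instance : CoeFun (PartialRep G B) (fun _ => G → B) := ⟨toFun⟩

/-- `ε g = π(g) π(g⁻¹)`. -/
def ε (π : PartialRep G B) (g : G) : B := π g * π g⁻¹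

lemma mul_ε (π : PartialRep G B) (g h : G) : π g * π.ε h = π.ε (g * h) * π g := by
  have h1 := π.mul_mul_inv g h
  have h2 := π.inv_mul_mul (g * h)⁻¹ g
  rw [ε, ε, ← mul_assoc, h1]
  simp only [inv_inv] at h2
  rw [h2]; simp

lemma ε_mul_self (π : PartialRep G B) (g : G) : π.ε g * π g = π g := by
  have := π.mul_mul_inv g g⁻¹
  simpa [π.map_one, ε] using this

lemma self_mul_ε (π : PartialRep G B) (g : G) : π g * π.ε g⁻¹ = π g := by
  rw [mul_ε, mul_inv_cancel]; simp [ε, π.map_one]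

lemma ε_mul_ε (π : PartialRep G B) (g : G) : π.ε g * π.ε g = π.ε g := by
  conv_lhs => rw [ε.eq_1 π g, ← mul_assoc]
  change π.ε g * π g * π g⁻¹ = _
  rw [ε_mul_self]; rfl

lemma ε_comm (π : PartialRep G B) (g h : G) : π.ε g * π.ε h = π.ε h * π.ε g := by
  have h1 : π.ε g * π.ε h = π g * (π g⁻¹ * π.ε h) := by rw [← mul_assoc]; rfl
  rw [h1, mul_ε, ← mul_assoc, mul_ε, mul_inv_cancel_left, mul_assoc]; rfl

end Basic

variable {K G B : Type*} [Field K] [Group G] [Ring B] [Algebra K B]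

variable (K) in
/-- The subalgebra generated by all `ε g` (it contains `ε 1 = 1`). -/
def alg (π : PartialRep G B) : Subalgebra K B := Algebra.adjoin K (Set.range π.ε)

lemma ε_mem (π : PartialRep G B) (g : G) : π.ε g ∈ π.alg K :=
  Algebra.subset_adjoin ⟨g, rfl⟩

lemma ε_comm_alg (π : PartialRep G B) (g : G) (a : B) (ha : a ∈ π.alg K) :
    π.ε g * a = a * π.ε g := by
  induction ha using Algebra.adjoin_induction with
  | mem x hx => obtain ⟨h, rfl⟩ := hx; exact π.ε_comm g h
  | algebraMap r => exact (Algebra.commutes r _).symm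
  | add x y _ _ hx hy => rw [mul_add, add_mul, hx, hy]
  | mul x y _ _ hx hy => rw [← mul_assoc, hx, mul_assoc, hy, mul_assoc]

lemma conj_mul (π : PartialRep G B) (g : G) (a b : B) (ha : a ∈ π.alg K) :
    π g * (a * b) * π g⁻¹ = (π g * a * π g⁻¹) * (π g * b * π g⁻¹) := by
  have h1 : (π g * a * π g⁻¹) * (π g * b * π g⁻¹) = π g * (a * π.ε g⁻¹) * b * π g⁻¹ := by
    simp [ε, mul_assoc]
  have h2 : π g * (π.ε g⁻¹ * a) = π g * a := by rw [← mul_assoc, self_mul_ε]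
  rw [h1, ← ε_comm_alg π g⁻¹ a ha, h2, ← mul_assoc]

lemma conj_mem (π : PartialRep G B) (g : G) (a : B) (ha : a ∈ π.alg K) :
    π g * a * π g⁻¹ ∈ π.alg K := by
  induction ha using Algebra.adjoin_induction with
  | mem x hx =>
    obtain ⟨h, rfl⟩ := hx
    rw [mul_ε, mul_assoc]
    exact mul_mem (π.ε_mem _) (π.ε_mem g)
  | algebraMap r =>
    rw [← Algebra.commutes, mul_assoc]
    exact mul_mem (Subalgebra.algebraMap_mem _ r) (π.ε_mem g)
  | add x y _ _ hx hy => rw [mul_add, add_mul]; exact add_mem hx hy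
  | mul x y hx' _ hx hy => rw [conj_mul π g x y hx']; exact mul_mem hx hy

/-- The ideal `D g = ε g · 𝒜` of the algebra `𝒜` generated by the `ε g`. -/
def dom (π : PartialRep G B) (g : G) : Submodule K (π.alg K) :=
  LinearMap.range (LinearMap.mulLeft K (⟨π.ε g, π.ε_mem g⟩ : π.alg K))

lemma mem_dom (π : PartialRep G B) (g : G) (a : π.alg K) :
    a ∈ π.dom g ↔ π.ε g * (a : B) = a := by
  constructor
  · rintro ⟨b, rfl⟩
    simp [← mul_assoc, ε_mul_ε]
  · intro h
    exact ⟨a, Subtype.ext h⟩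

lemma conj_mem_dom (π : PartialRep G B) (g : G) (a : π.alg K) :
    (⟨π g * a * π g⁻¹, π.conj_mem g a a.2⟩ : π.alg K) ∈ π.dom g := by
  rw [mem_dom]
  simp only [← mul_assoc, ε_mul_self]

lemma inv_conj_conj (π : PartialRep G B) (g : G) (a : π.alg K) (ha : a ∈ π.dom g⁻¹) :
    π g⁻¹ * (π g * a * π g⁻¹) * π g = a := by
  rw [mem_dom] at ha
  have h1 : π g⁻¹ * (π g * (a : B) * π g⁻¹) * π g = π.ε g⁻¹ * a * π.ε g⁻¹ := by
    simp [ε, mul_assoc]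
  rw [h1, ha, ← ε_comm_alg π _ _ a.2, ha]

lemma conj_inv_conj (π : PartialRep G B) (g : G) (a : π.alg K) (ha : a ∈ π.dom g) :
    π g * (π g⁻¹ * a * π g) * π g⁻¹ = a := by
  have := π.inv_conj_conj g⁻¹ a (by simpa using ha)
  simpa using this

/-- The isomorphism `D g⁻¹ → D g`, `a ↦ π(g) a π(g⁻¹)`, with inverse `a ↦ π(g⁻¹) a π(g)`. -/
def conj (π : PartialRep G B) (g : G) : π.dom (K := K) g⁻¹ ≃ₗ[K] π.dom (K := K) g where
  toFun a := ⟨⟨π g * a * π g⁻¹, π.conj_mem g _ a.1.2⟩, π.conj_mem_dom g a.1⟩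
  map_add' a b := by ext; simp [mul_add, add_mul]
  map_smul' c a := by ext; simp
  invFun a := ⟨⟨π g⁻¹ * a * π g, by simpa using π.conj_mem g⁻¹ _ a.1.2⟩, by
    simpa using π.conj_mem_dom g⁻¹ a.1⟩
  left_inv a := by ext; exact π.inv_conj_conj g a.1 a.2
  right_inv a := by ext; exact π.conj_inv_conj g a.1 a.2

lemma conj_apply (π : PartialRep G B) (g : G) (a : π.dom (K := K) g⁻¹) :
    ((π.conj g a : π.alg K) : B) = π g * a * π g⁻¹ := rfl

variable (K) in
/-- The partial action of `G` on the algebra generated by the `ε g` which is attached to a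
partial representation: `D g = ε g · 𝒜` and `a ↦ π(g) a π(g⁻¹)`. -/
def partialAction (π : PartialRep G B) : PartialAction K G (π.alg K) where
  D g := π.dom g
  mul_mem_left g a x hx := by
    rw [mem_dom] at hx ⊢
    rw [Subalgebra.coe_mul, ← mul_assoc, ε_comm_alg π g a a.2, mul_assoc, hx]
  mul_mem_right g a x hx := by
    rw [mem_dom] at hx ⊢
    rw [Subalgebra.coe_mul, ← mul_assoc, hx]
  act g := π.conj g
  act_mul g x y := by
    ext
    exact π.conj_mul g x y x.1.2
  D_one := by
    rw [eq_top_iff]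
    intro a _
    rw [mem_dom]
    simp [ε, π.map_one]
  act_one x := by
    ext
    simp [conj_apply, π.map_one]
  mem_of_act_mem g h x hx := by
    rw [mem_dom] at hx ⊢
    have hx0 := π.inv_conj_conj h x.1 x.2
    rw [conj_apply] at hx
    have e1 : π.ε (g * h)⁻¹ * π h⁻¹ = π h⁻¹ * π.ε g⁻¹ := by
      rw [mul_ε]; simp
    rw [← hx0, ← mul_assoc, ← mul_assoc, e1, mul_assoc (π h⁻¹), hx]
  act_act g h x hx := by
    ext
    simp only [conj_apply]
    have hx1 := (π.mem_dom _ _).1 x.2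
    have hx2 : (x : B) * π.ε h⁻¹ = x := by
      rw [← ε_comm_alg π _ _ x.1.2, hx1]
    have e1 : π h⁻¹ * π g⁻¹ = π.ε h⁻¹ * π (h⁻¹ * g⁻¹) := by
      have := π.inv_mul_mul h g⁻¹
      have h3 := π.inv_mul_mul h (h⁻¹ * g⁻¹)
      rw [mul_inv_cancel_left] at h3
      rw [← h3]; simp [ε]
    have e2 : π g * π h * π.ε h⁻¹ = π (g * h) * π.ε h⁻¹ := by
      have := π.mul_mul_inv g h
      simp only [ε, inv_inv]
      rw [← mul_assoc, ← mul_assoc, this]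
    calc π g * (π h * (x : B) * π h⁻¹) * π g⁻¹
        = π g * π h * (x * (π h⁻¹ * π g⁻¹)) := by simp [mul_assoc]
      _ = π g * π h * (π.ε h⁻¹ * x * π (h⁻¹ * g⁻¹)) := by
        rw [e1, ← mul_assoc (x : B), hx2, hx1]
      _ = π g * π h * π.ε h⁻¹ * x * π (h⁻¹ * g⁻¹) := by simp [mul_assoc]
      _ = π (g * h) * (π.ε h⁻¹ * x) * π (h⁻¹ * g⁻¹) := by rw [e2, mul_assoc (π (g * h))]
      _ = π (g * h) * x * π (g * h)⁻¹ := by rw [hx1, mul_inv_rev]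

open scoped Classical in
variable (K) in
/-- The canonical map `φ_π : 𝒜 ⋊ G → B`, `∑ a_g δ_g ↦ ∑ a_g π(g)`. -/
def phi (π : PartialRep G B) : (π.partialAction K).SkewGroupRing →ₗ[K] B :=
  DirectSum.toModule K G B fun g =>
    (LinearMap.mulRight K (π g)) ∘ₗ (π.alg K).val.toLinearMap ∘ₗ
      ((π.partialAction K).D g).subtype

open scoped Classical in
lemma phi_delta (π : PartialRep G B) (g : G) (a : (π.partialAction K).D g) :
    π.phi K ((π.partialAction K).delta g a) = (a : B) * π g := by
  simp only [phi, PartialAction.delta]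
  erw [DirectSum.toModule_lof]
  rfl

end PartialRep

/-! # Elementary partial representations and elementary gradings -/

/-- Right coset representatives `rep 0 = 1, …, rep (n - 1)` of the left stabilizer
`H = {h | hA = A}` in `A`: the set `A` is the disjoint union of the cosets `H (rep i)`. -/
structure StabReps {G : Type*} [Group G] (A : Set G) (n : ℕ) [NeZero n] where
  rep : Fin n → G
  rep_zero : rep 0 = 1
  eq_iUnion : A = ⋃ i, (fun h => h * rep i) '' (MulAction.stabilizer G A : Set G)
  coset_ne : ∀ i j, i ≠ j →
    (fun h => h * rep i) '' (MulAction.stabilizer G A : Set G) ≠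
      (fun h => h * rep j) '' (MulAction.stabilizer G A : Set G)

namespace StabReps

variable {G : Type*} [Group G] {A : Set G} {n : ℕ} [NeZero n]

/-- The sets `A_i = (rep i)⁻¹ A`, the objects of the groupoid `Γ`. -/
def obj (r : StabReps A n) (i : Fin n) : Set G := (r.rep i)⁻¹ • A

lemma smul_obj_eq_iff (r : StabReps A n) (i j : Fin n) (g : G) :
    g • r.obj i = r.obj j ↔ r.rep j * g * (r.rep i)⁻¹ ∈ MulAction.stabilizer G A := by
  rw [MulAction.mem_stabilizer_iff, obj, obj, ← inv_smul_eq_iff, inv_inv, smul_smul, smul_smul]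

lemma obj_injective (r : StabReps A n) : Function.Injective r.obj := by
  intro i j h
  by_contra hij
  apply r.coset_ne i j hij
  have h' : (1 : G) • r.obj i = r.obj j := by rw [one_smul, h]
  rw [smul_obj_eq_iff, mul_one] at h'
  ext x
  simp only [Set.mem_image, SetLike.mem_coe]
  constructor
  · rintro ⟨y, hy, rfl⟩
    exact ⟨y * (r.rep j * (r.rep i)⁻¹)⁻¹, mul_mem hy (inv_mem h'), by simp [mul_assoc]⟩
  · rintro ⟨y, hy, rfl⟩
    exact ⟨y * (r.rep j * (r.rep i)⁻¹), mul_mem hy h', by simp [mul_assoc]⟩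

lemma exists_smul_obj (r : StabReps A n) (i : Fin n) (g : G) (hg : g⁻¹ ∈ r.obj i) :
    ∃ j, g • r.obj i = r.obj j := by
  rw [obj, Set.mem_inv_smul_set_iff, smul_eq_mul] at hg
  have : r.rep i * g⁻¹ ∈ ⋃ i, (fun h => h * r.rep i) '' (MulAction.stabilizer G A : Set G) :=
    r.eq_iUnion ▸ hg
  obtain ⟨j, h, hh, e⟩ := Set.mem_iUnion.1 this
  refine ⟨j, ?_⟩
  rw [smul_obj_eq_iff]
  have : r.rep j * g * (r.rep i)⁻¹ = h⁻¹ := by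
    simp only at e
    rw [eq_inv_iff_mul_eq_one, mul_assoc _ _ h]
    have : h = r.rep i * g⁻¹ * (r.rep j)⁻¹ := by rw [← e]; simp
    rw [this]; group
  rw [this]
  exact inv_mem hh

lemma rep_mem (r : StabReps A n) (i : Fin n) : r.rep i ∈ A := by
  have h : r.rep i ∈ ⋃ i, (fun h => h * r.rep i) '' (MulAction.stabilizer G A : Set G) :=
    Set.mem_iUnion.2 ⟨i, 1, one_mem _, by simp⟩
  rwa [← r.eq_iUnion] at h

lemma inv_mem_obj (r : StabReps A n) {i j : Fin n} {g : G} (h : g • r.obj i = r.obj j) :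
    g⁻¹ ∈ r.obj i := by
  have h1 : (1 : G) ∈ r.obj j := by
    rw [obj, Set.mem_inv_smul_set_iff, smul_eq_mul, mul_one]; exact r.rep_mem j
  rw [← h, Set.mem_smul_set_iff_inv_smul_mem, smul_eq_mul, mul_one] at h1
  exact h1

/-- The morphisms of the groupoid `Γ`: pairs `(A_i, g)` such that `g A_i = A_j` for some `j`. -/
def Mor (r : StabReps A n) : Type _ :=
  {p : Fin n × G // ∃ j, p.2 • r.obj p.1 = r.obj j}

/-- The source `A_i` of the morphism `(A_i, g)`. -/
def Mor.src {r : StabReps A n} (γ : r.Mor) : Fin n := γ.1.1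

/-- The group element `g` of the morphism `(A_i, g)`. -/
def Mor.elt {r : StabReps A n} (γ : r.Mor) : G := γ.1.2

/-- The target `A_j = g A_i` of the morphism `(A_i, g)`. -/
def Mor.tgt {r : StabReps A n} (γ : r.Mor) : Fin n := γ.2.choose

lemma Mor.smul_src {r : StabReps A n} (γ : r.Mor) : γ.elt • r.obj γ.src = r.obj γ.tgt :=
  γ.2.choose_spec

/-- The element `(rep j) g (rep i)⁻¹` of `H` attached to the morphism `(A_i, g) : A_i → A_j`. -/
def Mor.isotropy {r : StabReps A n} (γ : r.Mor) : MulAction.stabilizer G A :=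
  ⟨r.rep γ.tgt * γ.elt * (r.rep γ.src)⁻¹, (r.smul_obj_eq_iff _ _ _).1 γ.smul_src⟩

variable (K : Type*) [Field K]

/-- The matrix algebra `M_n(KH)`, where `H` is the stabilizer of `A`. -/
abbrev Mat (_r : StabReps A n) : Type _ :=
  Matrix (Fin n) (Fin n) (MonoidAlgebra K (MulAction.stabilizer G A))

/-- The elementary matrix `e_{i,j}(h)`. -/
def elemMat (r : StabReps A n) (i j : Fin n) (h : MulAction.stabilizer G A) : r.Mat K :=
  Matrix.single i j (MonoidAlgebra.single h 1)

/-- The linear map `τ : KΓ → M_n(KH)`, `(A_i, g) ↦ e_{j,i}((rep j) g (rep i)⁻¹)`, on the space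
`KΓ` with basis the morphisms of `Γ`. -/
def tau (r : StabReps A n) : (r.Mor →₀ K) →ₗ[K] r.Mat K :=
  Finsupp.linearCombination K fun γ : r.Mor => r.elemMat K γ.tgt γ.src γ.isotropy

open scoped Classical in
/-- The map `λ : G → KΓ`, `λ(g) = ∑_{A_i ∋ g⁻¹} (A_i, g)`. -/
def lam (r : StabReps A n) (g : G) : r.Mor →₀ K :=
  ∑ i : Fin n, if hi : g⁻¹ ∈ r.obj i then
    Finsupp.single (⟨(i, g), r.exists_smul_obj i g hi⟩ : r.Mor) 1 else 0

open scoped Classical in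
lemma tau_lam_apply (r : StabReps A n) (g : G) (j i : Fin n) :
    r.tau K (r.lam K g) j i =
      if h : g • r.obj i = r.obj j then
        MonoidAlgebra.single ⟨r.rep j * g * (r.rep i)⁻¹, (r.smul_obj_eq_iff i j g).1 h⟩ 1
      else 0 := by
  have key : ∀ k : Fin n, (r.tau K (if hi : g⁻¹ ∈ r.obj k then
      Finsupp.single (⟨(k, g), r.exists_smul_obj k g hi⟩ : r.Mor) 1 else 0)) j i =
      if h : k = i ∧ g • r.obj i = r.obj j then
        MonoidAlgebra.single ⟨r.rep j * g * (r.rep i)⁻¹, (r.smul_obj_eq_iff i j g).1 h.2⟩ 1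
      else 0 := by
    intro k
    by_cases hk : g⁻¹ ∈ r.obj k
    · rw [dif_pos hk]
      set γ : r.Mor := ⟨(k, g), r.exists_smul_obj k g hk⟩ with hγ
      have hs : g • r.obj k = r.obj γ.tgt := γ.smul_src
      rw [tau, Finsupp.linearCombination_single, one_smul, elemMat]
      by_cases h : k = i ∧ g • r.obj i = r.obj j
      · rw [dif_pos h]
        obtain ⟨rfl, h⟩ := h
        have ht : γ.tgt = j := r.obj_injective (hs.symm.trans h)
        subst ht
        exact Matrix.single_apply_same _ _ _
      · rw [dif_neg h]
        apply Matrix.single_apply_of_ne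
        rintro ⟨h1, h2⟩
        apply h
        have h2' : k = i := h2
        subst h2'
        exact ⟨rfl, by rw [hs, h1]⟩
    · rw [dif_neg hk, map_zero, dif_neg]
      · rfl
      · rintro ⟨rfl, h⟩
        exact hk (r.inv_mem_obj h)
  rw [lam, map_sum, Matrix.sum_apply, Finset.sum_congr rfl fun k _ => key k]
  rw [Finset.sum_eq_single i]
  · simp
  · intro k _ hk
    simp [hk]
  · simp

open scoped Classical in
lemma mul_tau_lam (r : StabReps A n) (g : G) (X : r.Mat K) (i j k : Fin n)
    (h : g • r.obj i = r.obj k) :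
    (X * r.tau K (r.lam K g)) j i = X j k *
      MonoidAlgebra.single ⟨r.rep k * g * (r.rep i)⁻¹, (r.smul_obj_eq_iff i k g).1 h⟩ 1 := by
  rw [Matrix.mul_apply, Finset.sum_eq_single k]
  · rw [tau_lam_apply, dif_pos h]
  · intro l _ hl
    rw [tau_lam_apply, dif_neg, mul_zero]
    rw [h]; exact fun e => hl (r.obj_injective e).symm
  · simp

open scoped Classical in
lemma mul_tau_lam_zero (r : StabReps A n) (g : G) (X : r.Mat K) (i j : Fin n)
    (h : ∀ k, g • r.obj i ≠ r.obj k) : (X * r.tau K (r.lam K g)) j i = 0 := by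
  rw [Matrix.mul_apply]
  refine Finset.sum_eq_zero fun l _ => ?_
  rw [tau_lam_apply, dif_neg (h l), mul_zero]

open scoped Classical in
lemma tau_lam_mul (r : StabReps A n) (g : G) (X : r.Mat K) (i j k : Fin n)
    (h : g • r.obj k = r.obj j) :
    (r.tau K (r.lam K g) * X) j i =
      MonoidAlgebra.single ⟨r.rep j * g * (r.rep k)⁻¹, (r.smul_obj_eq_iff k j g).1 h⟩ 1 *
        X k i := by
  rw [Matrix.mul_apply, Finset.sum_eq_single k]
  · rw [tau_lam_apply, dif_pos h]
  · intro l _ hl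
    rw [tau_lam_apply, dif_neg, zero_mul]
    rw [← h]; exact fun e => hl (r.obj_injective (smul_left_cancel g e))
  · simp

open scoped Classical in
lemma tau_lam_mul_zero (r : StabReps A n) (g : G) (X : r.Mat K) (i j : Fin n)
    (h : ∀ k, g • r.obj k ≠ r.obj j) : (r.tau K (r.lam K g) * X) j i = 0 := by
  rw [Matrix.mul_apply]
  refine Finset.sum_eq_zero fun l _ => ?_
  rw [tau_lam_apply, dif_neg (h l), zero_mul]

lemma single_one_mul_single_one (x y : MulAction.stabilizer G A) :
    (MonoidAlgebra.single x 1 * MonoidAlgebra.single y 1 :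
      MonoidAlgebra K (MulAction.stabilizer G A)) = MonoidAlgebra.single (x * y) 1 := by
  rw [MonoidAlgebra.single_mul_single, one_mul]

open scoped Classical in
/-- The elementary partial representation `π = τ ∘ λ : G → M_n(KH)` constructed from `A` and the
sets `A_i = (rep i)⁻¹ A`. -/
def elemRep (r : StabReps A n) : PartialRep G (r.Mat K) where
  toFun g := r.tau K (r.lam K g)
  map_one := by
    ext1 j i
    rw [tau_lam_apply, Matrix.one_apply]
    by_cases h : j = i
    · subst h
      rw [dif_pos (one_smul _ _), if_pos rfl, MonoidAlgebra.one_def]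
      congr 1
      ext; simp
    · rw [if_neg h, dif_neg]
      rw [one_smul]; exact fun e => h (r.obj_injective e).symm
  mul_mul_inv g h := by
    ext1 j i
    by_cases hk : ∃ k, h⁻¹ • r.obj i = r.obj k
    · obtain ⟨k, hk⟩ := hk
      rw [mul_tau_lam K r _ _ i j k hk, mul_tau_lam K r _ _ i j k hk]
      congr 1
      have hk' : h • r.obj k = r.obj i := by rw [← hk, smul_inv_smul]
      rw [mul_tau_lam K r _ _ k j i hk', tau_lam_apply, tau_lam_apply]
      have e : (g * h) • r.obj k = r.obj j ↔ g • r.obj i = r.obj j := by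
        rw [← smul_smul, hk']
      by_cases hj : g • r.obj i = r.obj j
      · rw [dif_pos hj, dif_pos (e.2 hj), single_one_mul_single_one]
        congr 1
        ext; simp [mul_assoc]
      · rw [dif_neg hj, dif_neg (fun h' => hj (e.1 h')), zero_mul]
    · push Not at hk
      rw [mul_tau_lam_zero K r _ _ i j hk, mul_tau_lam_zero K r _ _ i j hk]
  inv_mul_mul g h := by
    ext1 j i
    rw [mul_assoc]
    by_cases hk : ∃ k, g⁻¹ • r.obj k = r.obj j
    · obtain ⟨k, hk⟩ := hk
      rw [tau_lam_mul K r _ _ i j k hk, tau_lam_mul K r _ _ i j k hk]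
      congr 1
      have hk' : g • r.obj j = r.obj k := by rw [← hk, smul_inv_smul]
      rw [tau_lam_mul K r _ _ i k j hk', tau_lam_apply, tau_lam_apply]
      have e : (g * h) • r.obj i = r.obj k ↔ h • r.obj i = r.obj j := by
        rw [← smul_smul, ← hk', smul_left_cancel_iff]
      by_cases hj : h • r.obj i = r.obj j
      · rw [dif_pos hj, dif_pos (e.2 hj), single_one_mul_single_one]
        congr 1
        ext; simp [mul_assoc]
      · rw [dif_neg hj, dif_neg (fun h' => hj (e.1 h')), mul_zero]
    · push Not at hk
      rw [tau_lam_mul_zero K r _ _ i j hk, tau_lam_mul_zero K r _ _ i j hk]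

/-- The degree `g` component of the elementary grading of `M_n(KH)` in which `e_{i,j}(h)` has
degree `(rep i)⁻¹ h (rep j)`. -/
def elemGrading (r : StabReps A n) (g : G) : Submodule K (r.Mat K) :=
  Submodule.span K {X | ∃ (i j : Fin n) (h : MulAction.stabilizer G A),
    (r.rep i)⁻¹ * (h : G) * r.rep j = g ∧ X = r.elemMat K i j h}

/-- The embedding `K^n ≅ diag(K, …, K) ⊆ M_n(KH)`. -/
def diagEmb (r : StabReps A n) : (Fin n → K) →ₐ[K] r.Mat K :=
  (Matrix.diagonalAlgHom K).comp
    (AlgHom.compLeft (Algebra.ofId K (MonoidAlgebra K (MulAction.stabilizer G A))) (Fin n))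

lemma diagEmb_apply (r : StabReps A n) (x : Fin n → K) :
    r.diagEmb K x = Matrix.diagonal fun i => algebraMap K _ (x i) := rfl

end StabReps

end

/-! Multiplicativity of `phi` is a formal fact about every partial representation (`phi_mul`). The
rest follows from comparing degrees.

The idempotent `ε g` is the diagonal 0/1 matrix marking the indices with `g ∈ A_i` (`ε_elemRep`).
The sets `A_i` are distinct, so these idempotents separate indices, and products of them and their
complements give every `e_{i,i}(1)`. Hence the algebra they generate consists of all scalar diagonal
matrices (`alg_elemRep`), which have degree 1. Since `π(g)` has degree `g`, `phi` preserves degrees.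

Conversely, `e_{i,j}(h) = e_{i,i}(1) π(g_i⁻¹ h g_j)` (`elemMat_one_mul_elemRep`), so every
homogeneous component is attained, and `phi` is onto. For injectivity it suffices to look at one
degree, where `a π(g) = 0` with `a ∈ D g` gives `a = a ε g = a π(g) π(g⁻¹) = 0`. -/

/-- The map `p i` kills the sum of all the other subspaces and is injective on `M i`, so the two
meet trivially. Both gradings are obtained from this criterion. -/
theorem isInternal_of_projections {ι K V : Type*} {W : ι → Type*} [DecidableEq ι] [Field K]
    [AddCommGroup V] [Module K V] [∀ i, AddCommGroup (W i)] [∀ i, Module K (W i)]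
    (M : ι → Submodule K V) (p : ∀ i, V →ₗ[K] W i)
    (hinj : ∀ i, ∀ x ∈ M i, p i x = 0 → x = 0)
    (hzero : ∀ i j, i ≠ j → ∀ x ∈ M j, p i x = 0) (htop : ⨆ i, M i = ⊤) :
    DirectSum.IsInternal M := by
  rw [DirectSum.isInternal_submodule_iff_iSupIndep_and_iSup_eq_top]
  refine ⟨fun i => Submodule.disjoint_def.2 fun x hx hx' => hinj i x hx ?_, htop⟩
  have hle : ⨆ j, ⨆ (_ : j ≠ i), M j ≤ LinearMap.ker (p i) :=
    iSup₂_le fun j hj y hy => hzero i j hj.symm y hy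
  exact hle hx'

/-! ### Coefficients and the canonical grading of a skew group ring. -/

namespace PartialAction

variable {K G A : Type*} [Field K] [Group G] [NonUnitalRing A] [Module K A]
  [IsScalarTower K A A] [SMulCommClass K A A]

theorem delta_induction (α : PartialAction K G A) {P : α.SkewGroupRing → Prop}
    (hz : P 0) (hd : ∀ g a, P (α.delta g a)) (ha : ∀ x y, P x → P y → P (x + y))
    (x : α.SkewGroupRing) : P x := by
  classical
  refine DirectSum.induction_on (motive := P) x hz (fun g a => ?_) ha
  convert hd g a
  simp only [delta]
  congr!

open scoped Classical in
/-- The coefficient at `g` of an element of the skew group ring. -/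
noncomputable def coeff (α : PartialAction K G A) (g : G) : α.SkewGroupRing →ₗ[K] α.D g :=
  DirectSum.component K G (fun g => α.D g) g

theorem coeff_delta_self (α : PartialAction K G A) (g : G) (a : α.D g) :
    α.coeff g (α.delta g a) = a := by
  classical
  simp only [coeff, delta]
  exact DirectSum.component.lof_self K (M := fun g => α.D g) g a

theorem coeff_delta_of_ne (α : PartialAction K G A) {g h : G} (hgh : h ≠ g) (a : α.D h) :
    α.coeff g (α.delta h a) = 0 := by
  classical
  simp only [coeff, delta]
  erw [DirectSum.component.of, dif_neg hgh]

theorem ext_coeff (α : PartialAction K G A) {x y : α.SkewGroupRing}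
    (h : ∀ g, α.coeff g x = α.coeff g y) : x = y :=
  DirectSum.ext_component K h

theorem isGroupGrading_homogeneous (α : PartialAction K G A) :
    IsGroupGrading α.homogeneous where
  isInternal := by
    classical
    refine isInternal_of_projections _ α.coeff ?_ ?_ ?_
    · rintro g _ ⟨a, rfl⟩ h
      rw [coeff_delta_self] at h
      rw [h, map_zero]
    · rintro g h hgh _ ⟨a, rfl⟩
      exact α.coeff_delta_of_ne hgh.symm a
    · refine eq_top_iff.2 fun x _ => ?_
      induction x using α.delta_induction with
      | hz => exact zero_mem _
      | hd g a => exact Submodule.mem_iSup_of_mem g ⟨a, rfl⟩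
      | ha x y hx hy => exact add_mem (hx trivial) (hy trivial)
  mul_mem := by
    rintro g h _ _ ⟨a, rfl⟩ ⟨b, rfl⟩
    rw [delta_mul_delta]
    exact ⟨_, rfl⟩

end PartialAction

/-! ### The canonical map of an arbitrary partial representation. -/

namespace PartialRep

variable {K G B : Type*} [Field K] [Group G] [Ring B] [Algebra K B]

/-- On `a δ_g` and `b δ_h`, the idempotent `π(g⁻¹) π(g)` created by `π(g⁻¹) π(gh) = π(g⁻¹) π(g)
π(h)` commutes past `b` and is absorbed by `π(g)`; on the left, `ε g` fixes `a`. -/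
theorem phi_mul (π : PartialRep G B) (x y : (π.partialAction K).SkewGroupRing) :
    π.phi K (x * y) = π.phi K x * π.phi K y := by
  induction x using (π.partialAction K).delta_induction with
  | hz => simp
  | ha x x' hx hx' => rw [add_mul, map_add, hx, hx', map_add, add_mul]
  | hd g a =>
  induction y using (π.partialAction K).delta_induction with
  | hz => simp
  | ha y y' hy hy' => rw [mul_add, map_add, hy, hy', map_add, mul_add]
  | hd h b =>
  rw [PartialAction.delta_mul_delta, phi_delta, phi_delta, phi_delta,
    PartialAction.coeffMul_apply]
  -- The inverse of `act g` is by construction `a ↦ π(g⁻¹) a π(g)`.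
  change π g * ((π g⁻¹ * (a : B) * π g) * (b : B)) * π g⁻¹ * π (g * h) = _
  have ha : π g * π g⁻¹ * (a : B) = a := (π.mem_dom g a.1).1 a.2
  have hg : π g⁻¹ * π (g * h) = π g⁻¹ * π g * π h := (π.inv_mul_mul g h).symm
  have hε : π g * (π g⁻¹ * π g) = π g := by simpa [ε] using π.self_mul_ε g
  have hb : (b : B) * (π g⁻¹ * π g) = π g⁻¹ * π g * b := by
    simpa [ε] using (π.ε_comm_alg g⁻¹ (b : B) b.1.2).symm
  calc π g * ((π g⁻¹ * (a : B) * π g) * (b : B)) * π g⁻¹ * π (g * h)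
      = (π g * π g⁻¹ * a) * π g * b * (π g⁻¹ * π (g * h)) := by simp only [mul_assoc]
    _ = a * π g * (b * (π g⁻¹ * π g)) * π h := by rw [ha, hg]; simp only [mul_assoc]
    _ = a * (π g * (π g⁻¹ * π g)) * b * π h := by rw [hb]; simp only [mul_assoc]
    _ = a * π g * (b * π h) := by rw [hε, mul_assoc]

/-- Replacing `b` by `ε g * b ∈ D g` does not change `b π(g)`, because `ε g` commutes with `b` and
fixes `π(g)`. -/
theorem exists_mul_eq (π : PartialRep G B) (g : G) (b : B) (hb : b ∈ π.alg K) :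
    ∃ a : (π.partialAction K).D g, (a : B) * π g = b * π g := by
  refine ⟨⟨⟨π.ε g * b, mul_mem (π.ε_mem g) hb⟩, (π.mem_dom g _).2 ?_⟩, ?_⟩
  · rw [← mul_assoc, ε_mul_ε]
  · change π.ε g * b * π g = _
    rw [π.ε_comm_alg g b hb, mul_assoc, ε_mul_self]

/-- Right multiplication by `π(g⁻¹)` recovers `a`, since `a ε g = a` on `D g`. -/
theorem eq_zero_of_mul_eq_zero (π : PartialRep G B) (g : G) (a : (π.partialAction K).D g)
    (h : (a : B) * π g = 0) : a = 0 := by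
  have ha : π.ε g * (a : B) = a := (π.mem_dom g a.1).1 a.2
  rw [π.ε_comm_alg g _ a.1.2, ε, ← mul_assoc, h, zero_mul] at ha
  exact Subtype.ext (Subtype.ext ha.symm)

end PartialRep

/-! ### The elementary grading of the matrix algebra. -/

namespace StabReps

variable {G : Type*} [Group G] {A : Set G} {n : ℕ} [NeZero n] (K : Type*) [Field K]

theorem elemMat_mem_elemGrading (r : StabReps A n) (i j : Fin n)
    (h : MulAction.stabilizer G A) :
    r.elemMat K i j h ∈ r.elemGrading K ((r.rep i)⁻¹ * (h : G) * r.rep j) :=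
  Submodule.subset_span ⟨i, j, h, rfl, rfl⟩

theorem span_elemMat (r : StabReps A n) (X : r.Mat K) :
    X ∈ Submodule.span K
      {Y | ∃ (i j : Fin n) (h : MulAction.stabilizer G A), Y = r.elemMat K i j h} := by
  rw [Matrix.matrix_eq_sum_single X]
  refine sum_mem fun i _ => sum_mem fun j _ => ?_
  induction X i j using MonoidAlgebra.induction_linear with
  | zero => simp
  | add f g hf hg => rw [Matrix.single_add]; exact add_mem hf hg
  | single h c =>
    have e : Matrix.single i j (MonoidAlgebra.single h c) = c • r.elemMat K i j h := by
      rw [elemMat, Matrix.smul_single, MonoidAlgebra.smul_single, smul_eq_mul, mul_one]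
    rw [e]
    exact Submodule.smul_mem _ _ (Submodule.subset_span ⟨i, j, h, rfl⟩)

theorem elemMat_mul_elemMat (r : StabReps A n) (i j l : Fin n)
    (h h' : MulAction.stabilizer G A) :
    r.elemMat K i j h * r.elemMat K j l h' = r.elemMat K i l (h * h') := by
  rw [elemMat, elemMat, Matrix.single_mul_single_same, single_one_mul_single_one]
  rfl

theorem elemMat_mul_elemMat_of_ne (r : StabReps A n) (i l : Fin n) {j k : Fin n} (hjk : j ≠ k)
    (h h' : MulAction.stabilizer G A) :
    r.elemMat K i j h * r.elemMat K k l h' = 0 :=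
  Matrix.single_mul_single_of_ne _ _ _ _ hjk _

open scoped Classical in
/-- The coordinates of a matrix at the elementary matrices of degree `g`. -/
noncomputable def degreeCoord (r : StabReps A n) (g : G) :
    r.Mat K →ₗ[K] (Fin n → Fin n → MulAction.stabilizer G A → K) where
  toFun X i j h := if (r.rep i)⁻¹ * (h : G) * r.rep j = g then (X i j).coeff h else 0
  map_add' X Y := by ext i j h; simp [ite_add_ite]
  map_smul' c X := by ext i j h; simp

/-- Masking loses nothing in degree `g`: an elementary matrix of degree `g` has coefficient zero at
every triple `(i, j, h)` of another degree. -/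
theorem degreeCoord_apply_of_mem (r : StabReps A n) {g : G} {X : r.Mat K}
    (hX : X ∈ r.elemGrading K g) (i j : Fin n) (h : MulAction.stabilizer G A) :
    r.degreeCoord K g X i j h = (X i j).coeff h := by
  induction hX using Submodule.span_induction with
  | zero => simp
  | add X Y _ _ hX hY => simp [hX, hY]
  | smul c X _ hX => simp [hX]
  | mem X hX =>
    obtain ⟨i', j', h', rfl, rfl⟩ := hX
    simp only [degreeCoord, LinearMap.coe_mk, AddHom.coe_mk, ite_eq_left_iff]
    intro hne
    by_cases hij : i' = i ∧ j' = j
    · obtain ⟨rfl, rfl⟩ := hij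
      have hh : h' ≠ h := by rintro rfl; exact hne rfl
      simp [elemMat, hh]
    · rw [elemMat, Matrix.single_apply_of_ne _ _ _ _ _ hij]; rfl

theorem degreeCoord_injOn (r : StabReps A n) {g : G} {X : r.Mat K}
    (hX : X ∈ r.elemGrading K g) (h0 : r.degreeCoord K g X = 0) : X = 0 := by
  ext i j h
  rw [← r.degreeCoord_apply_of_mem K hX, h0]; rfl

/-- At a triple of degree `g` the mask for `g'` returns zero, yet on `X` it returns the true
coefficient. -/
theorem degreeCoord_eq_zero (r : StabReps A n) {g g' : G} (hg : g ≠ g') {X : r.Mat K}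
    (hX : X ∈ r.elemGrading K g') : r.degreeCoord K g X = 0 := by
  ext i j h
  have h1 := r.degreeCoord_apply_of_mem K hX i j h
  simp only [degreeCoord, LinearMap.coe_mk, AddHom.coe_mk, ite_eq_left_iff] at h1 ⊢
  simp only [Pi.zero_apply, ite_eq_right_iff]
  rintro rfl
  exact (h1 hg).symm

theorem iSup_elemGrading (r : StabReps A n) : ⨆ g, r.elemGrading K g = ⊤ := by
  refine eq_top_iff.2 fun X _ => (Submodule.span_le.2 ?_) (r.span_elemMat K X)
  rintro _ ⟨i, j, h, rfl⟩
  exact Submodule.mem_iSup_of_mem _ (r.elemMat_mem_elemGrading K i j h)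

/-- By bilinearity only elementary matrices matter: either the inner indices differ and the product
is zero, or the inner factor `g_j g_j⁻¹` cancels. -/
theorem elemGrading_mul_mem (r : StabReps A n) {g g' : G} {X Y : r.Mat K}
    (hX : X ∈ r.elemGrading K g) (hY : Y ∈ r.elemGrading K g') :
    X * Y ∈ r.elemGrading K (g * g') := by
  induction hX using Submodule.span_induction with
  | zero => simp
  | add X X' _ _ hX hX' => rw [add_mul]; exact add_mem hX hX'
  | smul c X _ hX => rw [smul_mul_assoc]; exact Submodule.smul_mem _ _ hX
  | mem X hX =>
  induction hY using Submodule.span_induction with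
  | zero => simp
  | add Y Y' _ _ hY hY' => rw [mul_add]; exact add_mem hY hY'
  | smul c Y _ hY => rw [mul_smul_comm]; exact Submodule.smul_mem _ _ hY
  | mem Y hY =>
  obtain ⟨i, j, h, rfl, rfl⟩ := hX
  obtain ⟨k, l, h', rfl, rfl⟩ := hY
  by_cases hjk : j = k
  · subst hjk
    rw [elemMat_mul_elemMat]
    convert r.elemMat_mem_elemGrading K i l (h * h') using 2
    simp [mul_assoc]
  · rw [elemMat_mul_elemMat_of_ne K r i l hjk]; exact zero_mem _

theorem isGroupGrading_elemGrading (r : StabReps A n) : IsGroupGrading (r.elemGrading K) where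
  isInternal := by
    classical
    exact isInternal_of_projections _ (r.degreeCoord K)
      (fun _ _ hX h0 => r.degreeCoord_injOn K hX h0)
      (fun _ _ hg _ hX => r.degreeCoord_eq_zero K hg hX) (r.iSup_elemGrading K)
  mul_mem _ _ _ _ hX hY := r.elemGrading_mul_mem K hX hY

/-! ### Scalar diagonal matrices and the algebra generated by the idempotents. -/

theorem diagEmb_injective (r : StabReps A n) : Function.Injective (r.diagEmb K) := by
  intro x y hxy
  rw [diagEmb_apply, diagEmb_apply] at hxy
  funext i
  exact FaithfulSMul.algebraMap_injective K _ (congrFun (Matrix.diagonal_injective hxy) i)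

theorem diagEmb_single (r : StabReps A n) (i : Fin n) :
    r.diagEmb K (Pi.single i 1) = r.elemMat K i i 1 := by
  rw [diagEmb_apply, elemMat, ← Matrix.diagonal_single]
  congr 1
  funext j
  by_cases hj : j = i
  · subst hj; simp
  · simp [hj]

theorem diagEmb_eq_sum (r : StabReps A n) (x : Fin n → K) :
    r.diagEmb K x = ∑ i, x i • r.elemMat K i i 1 := by
  simp only [← diagEmb_single, ← map_smul, ← map_sum]
  congr 1
  exact pi_eq_sum_univ' x

theorem diagEmb_mem_elemGrading (r : StabReps A n) (x : Fin n → K) :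
    r.diagEmb K x ∈ r.elemGrading K 1 := by
  rw [diagEmb_eq_sum]
  refine sum_mem fun i _ => Submodule.smul_mem _ _ ?_
  simpa using r.elemMat_mem_elemGrading K i i 1

/-- Each summand `e_{j,i}(g_j g g_i⁻¹)` has degree `g_j⁻¹ (g_j g g_i⁻¹) g_i = g`. -/
theorem elemRep_mem_elemGrading (r : StabReps A n) (g : G) :
    r.elemRep K g ∈ r.elemGrading K g := by
  change r.tau K (r.lam K g) ∈ _
  rw [lam, map_sum]
  refine sum_mem fun i _ => ?_
  split_ifs with hi
  · set γ : r.Mor := ⟨(i, g), r.exists_smul_obj i g hi⟩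
    have e : (r.rep γ.tgt)⁻¹ * (γ.isotropy : G) * r.rep γ.src = g := by
      change (r.rep γ.tgt)⁻¹ * (r.rep γ.tgt * g * (r.rep i)⁻¹) * r.rep i = g
      group
    rw [tau, Finsupp.linearCombination_single, one_smul]
    have := r.elemMat_mem_elemGrading K γ.tgt γ.src γ.isotropy
    rwa [e] at this
  · simp

-- The factor `π(g⁻¹)` carries `A_i` to some `A_k` exactly when `g ∈ A_i`; then `π(g)` carries it
-- back and the two labels in `H` cancel.
open scoped Classical in
theorem ε_elemRep (r : StabReps A n) (g : G) :
    (r.elemRep K).ε g = r.diagEmb K fun i => if g ∈ r.obj i then 1 else 0 := by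
  change r.tau K (r.lam K g) * r.tau K (r.lam K g⁻¹) = _
  ext1 j i
  rw [diagEmb_apply, Matrix.diagonal_apply]
  by_cases hk : ∃ k, g⁻¹ • r.obj i = r.obj k
  · obtain ⟨k, hk⟩ := hk
    have hk' : g • r.obj k = r.obj i := by rw [← hk, smul_inv_smul]
    rw [mul_tau_lam K r _ _ i j k hk, tau_lam_apply]
    have hgi : g ∈ r.obj i := by simpa using r.inv_mem_obj hk
    by_cases hji : j = i
    · subst hji
      rw [dif_pos hk', single_one_mul_single_one, if_pos rfl, if_pos hgi, map_one,
        MonoidAlgebra.one_def]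
      congr 1
      ext; simp [mul_assoc]
    · rw [if_neg hji, dif_neg, zero_mul]
      rw [hk']; exact fun e => hji (r.obj_injective e).symm
  · have hgi : g ∉ r.obj i := fun hg =>
      hk (r.exists_smul_obj i g⁻¹ (by rwa [inv_inv]))
    push Not at hk
    rw [mul_tau_lam_zero K r _ _ i j hk]
    split_ifs with hji hgj
    · subst hji; exact absurd hgj hgi
    · simp
    · rfl

/-- For each `j ≠ i` some `g` lies in exactly one of `A_i`, `A_j`, so `ε g` or `1 - ε g` is 1 at `i`
and 0 at `j`. The product of these over `j` isolates the index `i`. -/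
theorem elemMat_one_mem_alg (r : StabReps A n) (i : Fin n) :
    r.elemMat K i i 1 ∈ (r.elemRep K).alg K := by
  classical
  have hsep : ∀ j, ∃ x : Fin n → K, r.diagEmb K x ∈ (r.elemRep K).alg K ∧ x i = 1 ∧
      (j ≠ i → x j = 0) := by
    intro j
    by_cases hj : j = i
    -- The neutral factor at `j = i` lets the product run over all indices.
    · exact ⟨1, by rw [map_one]; exact one_mem _, rfl, fun h => absurd hj h⟩
    obtain ⟨g, hg⟩ : ∃ g, ¬ (g ∈ r.obj j ↔ g ∈ r.obj i) := by
      by_contra! h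
      exact hj (r.obj_injective (Set.ext h))
    have hmem := (r.elemRep K).ε_mem (K := K) g
    rw [ε_elemRep] at hmem
    by_cases hgi : g ∈ r.obj i
    · have hgj : g ∉ r.obj j := fun h => hg (iff_of_true h hgi)
      exact ⟨_, hmem, if_pos hgi, fun _ => if_neg hgj⟩
    · have hgj : g ∈ r.obj j := by by_contra h; exact hg (iff_of_false h hgi)
      refine ⟨1 - fun k => if g ∈ r.obj k then 1 else 0,
        by rw [map_sub, map_one]; exact sub_mem (one_mem _) hmem, ?_, fun _ => ?_⟩
      · simp [hgi]
      · simp [hgj]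
  choose x hx hxi hxj using hsep
  have hprod : ∏ j, x j = Pi.single i 1 := by
    funext k
    rw [Finset.prod_apply]
    by_cases hk : k = i
    · subst hk; simp [hxi]
    · rw [Pi.single_eq_of_ne hk]
      exact Finset.prod_eq_zero (Finset.mem_univ k) (hxj k hk)
  -- The product is formed in the commutative algebra `K^n`, inside the preimage of the generated
  -- subalgebra, since the matrix algebra need not be commutative.
  have hcomap : ∏ j, x j ∈ ((r.elemRep K).alg K).comap (r.diagEmb K) :=
    prod_mem fun j _ => hx j
  rw [← diagEmb_single, ← hprod]
  exact hcomap

theorem alg_elemRep (r : StabReps A n) : (r.elemRep K).alg K = (r.diagEmb K).range := by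
  classical
  refine le_antisymm (Algebra.adjoin_le ?_) ?_
  · rintro _ ⟨g, rfl⟩
    rw [ε_elemRep]
    exact ⟨_, rfl⟩
  · rintro _ ⟨x, rfl⟩
    change r.diagEmb K x ∈ _
    rw [diagEmb_eq_sum]
    exact sum_mem fun i _ => Subalgebra.smul_mem _ (r.elemMat_one_mem_alg K i) _

/-! ### The graded isomorphism. -/

/-- With `g = g_i⁻¹ h g_j` one has `g A_j = A_i`, so row `i` of `π(g)` has its only nonzero entry in
column `j`, namely `g_i g g_j⁻¹ = h`. The factor `e_{i,i}(1)` selects that row. -/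
theorem elemMat_one_mul_elemRep (r : StabReps A n) (i j : Fin n)
    (h : MulAction.stabilizer G A) :
    r.elemMat K i i 1 * r.elemRep K ((r.rep i)⁻¹ * (h : G) * r.rep j) = r.elemMat K i j h := by
  change _ * r.tau K (r.lam K _) = _
  have hij : ((r.rep i)⁻¹ * (h : G) * r.rep j) • r.obj j = r.obj i := by
    rw [smul_obj_eq_iff]; simp [mul_assoc]
  rw [← diagEmb_single, diagEmb_apply]
  ext1 k l
  rw [Matrix.diagonal_mul, tau_lam_apply, elemMat, Matrix.single_apply]
  by_cases hk : k = i
  · subst hk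
    rw [Pi.single_eq_same, map_one, one_mul]
    by_cases hl : l = j
    · subst hl
      rw [dif_pos hij, if_pos ⟨rfl, rfl⟩]
      congr 1
      ext; simp [mul_assoc]
    · rw [dif_neg, if_neg fun e => hl e.2.symm]
      rw [← hij]
      exact fun e => hl (r.obj_injective (smul_left_cancel _ e))
  · rw [Pi.single_eq_of_ne hk, map_zero, zero_mul, if_neg fun e => hk e.1.symm]

theorem phi_delta_mem_elemGrading (r : StabReps A n) (g : G)
    (a : ((r.elemRep K).partialAction K).D g) :
    (r.elemRep K).phi K (((r.elemRep K).partialAction K).delta g a) ∈ r.elemGrading K g := by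
  rw [PartialRep.phi_delta]
  have ha : ((a : (r.elemRep K).alg K) : r.Mat K) ∈ (r.diagEmb K).range :=
    alg_elemRep K r ▸ a.1.2
  obtain ⟨x, hx⟩ := ha
  have hx' : r.diagEmb K x = a := hx
  rw [← hx']
  simpa using r.elemGrading_mul_mem K (r.diagEmb_mem_elemGrading K x)
    (r.elemRep_mem_elemGrading K g)

theorem map_phi_homogeneous (r : StabReps A n) (g : G) :
    (((r.elemRep K).partialAction K).homogeneous g).map ((r.elemRep K).phi K) =
      r.elemGrading K g := by
  refine le_antisymm ?_ (Submodule.span_le.2 ?_)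
  · rintro _ ⟨_, ⟨a, rfl⟩, rfl⟩
    exact r.phi_delta_mem_elemGrading K g a
  · rintro _ ⟨i, j, h, rfl, rfl⟩
    set g := (r.rep i)⁻¹ * (h : G) * r.rep j with hg
    -- The matrix `e_{i,i}(1)` is only known to lie in the generated algebra, so it is traded for an
    -- element of `D g` with the same product with `π(g)`.
    obtain ⟨a, ha⟩ := (r.elemRep K).exists_mul_eq (K := K) g _ (r.elemMat_one_mem_alg K i)
    refine ⟨_, ⟨a, rfl⟩, ?_⟩
    rw [PartialRep.phi_delta, ha, hg, elemMat_one_mul_elemRep]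

theorem phi_injective (r : StabReps A n) : Function.Injective ((r.elemRep K).phi K) := by
  rw [injective_iff_map_eq_zero]
  intro x hx
  -- The degree `g` coordinates of the image of `y` depend only on the component of `y` at `g`; this
  -- reduces injectivity to a single degree.
  have key : ∀ (g : G) (y : ((r.elemRep K).partialAction K).SkewGroupRing),
      r.degreeCoord K g ((r.elemRep K).phi K y) = r.degreeCoord K g ((r.elemRep K).phi K
        (((r.elemRep K).partialAction K).delta g
          (((r.elemRep K).partialAction K).coeff g y))) := by
    intro g y
    induction y using PartialAction.delta_induction with
    | hz => simp
    | ha y y' hy hy' => simp only [map_add, hy, hy']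
    | hd h a =>
      by_cases hgh : h = g
      · subst hgh; rw [PartialAction.coeff_delta_self]
      · rw [PartialAction.coeff_delta_of_ne _ hgh, map_zero, map_zero, map_zero]
        exact r.degreeCoord_eq_zero K (Ne.symm hgh) (r.phi_delta_mem_elemGrading K h a)
  refine PartialAction.ext_coeff _ fun g => ?_
  rw [map_zero]
  refine (r.elemRep K).eq_zero_of_mul_eq_zero g _ ?_
  rw [← PartialRep.phi_delta]
  refine r.degreeCoord_injOn K (r.phi_delta_mem_elemGrading K g _) ?_
  rw [← key, hx, map_zero]

theorem phi_surjective (r : StabReps A n) : Function.Surjective ((r.elemRep K).phi K) := by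
  rw [← LinearMap.range_eq_top, eq_top_iff, ← r.iSup_elemGrading K]
  refine iSup_le fun g => ?_
  rw [← map_phi_homogeneous]
  exact LinearMap.map_le_range

end StabReps

theorem corollary6p13 {K G : Type*} [Field K] [Group G] (A : Set G) (n : ℕ) [NeZero n]
    (r : StabReps A n) :
    -- the elementary grading of `M_n(KH)` and the canonical grading of the skew group ring
    IsGroupGrading (r.elemGrading K) ∧
    IsGroupGrading ((r.elemRep K).partialAction K).homogeneous ∧
    -- the algebra acted upon is `diag(K, …, K)`, a copy of `K^n`
    Function.Injective (r.diagEmb K) ∧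
    (r.elemRep K).alg K = (r.diagEmb K).range ∧
    -- `φ_π` is a bijective linear map, multiplicative and compatible with the gradings
    Function.Bijective ((r.elemRep K).phi K) ∧
    (∀ x y : ((r.elemRep K).partialAction K).SkewGroupRing,
      (r.elemRep K).phi K (x * y) = (r.elemRep K).phi K x * (r.elemRep K).phi K y) ∧
    (∀ g : G, (((r.elemRep K).partialAction K).homogeneous g).map ((r.elemRep K).phi K) =
      r.elemGrading K g) :=
  ⟨r.isGroupGrading_elemGrading K, PartialAction.isGroupGrading_homogeneous _,
    r.diagEmb_injective K, r.alg_elemRep K, ⟨r.phi_injective K, r.phi_surjective K⟩,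
    (r.elemRep K).phi_mul, r.map_phi_homogeneous K⟩
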